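/- Let $k:\mathbb{R}^d\times\mathbb{R}^d\to\mathbb{R}$ be a continuous kernel with $|k(z,z')|<K$ for all $z,z'\in\mathbb{R}^d$, which is the reproducing kernel of a universal reproducing kernel Hilbert space $\mathcal{H}_k$; universal means here that every continuous function on $\mathbb{R}^d$ vanishing at infinity is a uniform limit of functions in $\mathcal{H}_k$. Let $H,F_1,F_2$ be Borel probability measures on $\mathbb{R}^d$. For weights $J=(J_1,\dots,J_N)$ and points $V=(V_1,\dots,V_N)$, $Y=(Y_1,\dots,Y_m)$ put $$D(J,V,Y)=\sum_{\ell,t=1}^{N}J_\ell J_t\,k(V_\ell,V_t)-\frac{2}{m}\sum_{\ell=1}^{N}\sum_{t=1}^{m}J_\ell\,k(V_\ell,Y_t)+\frac{1}{m^2}\sum_{\ell,t=1}^{m}k(Y_\ell,Y_t).$$ The prior-based estimator $\mathrm{MMD}^2_{\mathrm{BNP}}(F^{pri}_{1,N},F_{2,m})$ is $D(J,V,Y)$ where $J\sim\mathrm{Dirichlet}(a/N,\dots,a/N)$, $V_1,\dots,V_N$ are i.i.d. from $H$, $Y_1,\dots,Y_m$ are i.i.d. from $F_2$, and $J,V,Y$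 are independent. Given a sample $X_1,\dots,X_n$ with empirical distribution $F_{1,n}$, the posterior-based estimator $\mathrm{MMD}^2_{\mathrm{BNP}}(F^{pos}_{1,N},F_{2,m})$ is $D(J^*,V^*,Y)$ where $J^*\sim\mathrm{Dirichlet}(\frac{a+n}{N},\dots,\frac{a+n}{N})$, $V^*_1,\dots,V^*_N$ are i.i.d. from $H^*=\frac{a}{a+n}H+\frac{n}{a+n}F_{1,n}$, $Y_1,\dots,Y_m$ are i.i.d. from $F_2$, and $J^*,V^*,Y$ are independent; its expectation $E$ is taken given the sample. All limits below are joint limits. (i.a) $E\big(\mathrm{MMD}^2_{\mathrm{BNP}}(F^{pri}_{1,N},F_{2,m})\big)\to0$ as $a,N,m\to\infty$ if and only if $H=F_2$. (i.b) For every fixed sample $X_1,\dots,X_n\in\mathbb{R}^d$, $E\big(\mathrm{MMD}^2_{\mathrm{BNP}}(F^{pos}_{1,N},F_{2,m})\big)\to0$ as $a,N,m\to\infty$ if and only if $H=F_2$. (ii) Let $X_1,X_2,\dots$ be i.i.d. from $F_1$. For every real $a\ge0$ and every $H$, almost surely with respect to $(X_i)_{i\ge1}$: $E\big(\mathrm{MMD}^2_{\mathrm{BNP}}(F^{pos}_{1,N},F_{2,m})\big)\to0$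 as $N,n,m\to\infty$ if and only if $F_1=F_2$. -/

import Mathlib

open MeasureTheory ProbabilityTheory Filter Topology

noncomputable section

/-- `k` is the (real-valued) reproducing kernel of the reproducing kernel Hilbert space `ℋ` of
functions on `E`: `h x = ⟪h, k x ·⟫` for all `h` in `ℋ`. Mathlib's kernel takes values in the
continuous linear maps `ℝ →L[ℝ] ℝ`, which are identified with numbers by evaluation at `1`. -/
def IsReproducingKernelOf {E : Type*} (k : E → E → ℝ) (ℋ : Type*) [NormedAddCommGroup ℋ]
    [InnerProductSpace ℝ ℋ] [CompleteSpace ℋ] [RKHS ℝ ℋ E ℝ] : Prop :=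
  ∀ x y, k x y = RKHS.kernel ℋ x y 1

/-- Universality of an RKHS on a (locally compact) space: every continuous function vanishing at
infinity is a uniform limit of functions of the RKHS. If the RKHS consists of functions vanishing
at infinity this is `c₀`-universality, and on a compact space it is density in the space of
continuous functions with respect to the uniform norm. -/
def IsUniversalRKHS {E : Type*} [TopologicalSpace E] (ℋ : Type*) [NormedAddCommGroup ℋ]
    [InnerProductSpace ℝ ℋ] [RKHS ℝ ℋ E ℝ] : Prop :=
  ∀ f : ZeroAtInftyContinuousMap E ℝ, ∀ ε : ℝ, 0 < ε → ∃ h : ℋ, ∀ x : E, |f x - h x| < ε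

/-- The Dirichlet distribution with (positive) parameters `α i`: the law of
`(G i / ∑ j, G j)` for independent `G i ∼ Gamma (α i, 1)`. -/
def dirichletMeasure {ι : Type*} [Fintype ι] (α : ι → ℝ) : Measure (ι → ℝ) :=
  (Measure.pi fun i => gammaMeasure (α i) 1).map fun g i => g i / ∑ j, g j

/-- The squared MMD between the weighted discrete measure `∑ ℓ, J ℓ • δ_{V ℓ}` and the empirical
measure of `Y`. -/
def mmdBNP {E : Type*} (k : E → E → ℝ) {N m : ℕ} (J : Fin N → ℝ) (V : Fin N → E)
    (Y : Fin m → E) : ℝ :=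
  ∑ ℓ, ∑ t, J ℓ * J t * k (V ℓ) (V t) - 2 / (m : ℝ) * ∑ ℓ, ∑ t, J ℓ * k (V ℓ) (Y t)
    + 1 / (m : ℝ) ^ 2 * ∑ ℓ, ∑ t, k (Y ℓ) (Y t)

/-- The joint law of the independent variables
`J ∼ Dirichlet (a/N, …, a/N)`, `V₁, …, V_N` i.i.d. from `H`, and `Y₁, …, Y_m` i.i.d. from `F₂`. -/
def samplingLaw {E : Type*} [MeasurableSpace E] (a : ℝ) (H F₂ : Measure E) (N m : ℕ) :
    Measure ((Fin N → ℝ) × (Fin N → E) × (Fin m → E)) :=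
  (dirichletMeasure fun _ : Fin N => a / N).prod
    ((Measure.pi fun _ => H).prod (Measure.pi fun _ => F₂))

/-- The expectation of the prior-based estimator for the prior `DP (a, H)`. -/
def expectedPriorMMD {E : Type*} [MeasurableSpace E] (k : E → E → ℝ) (a : ℝ) (H F₂ : Measure E)
    (N m : ℕ) : ℝ :=
  ∫ z, mmdBNP k z.1 z.2.1 z.2.2 ∂(samplingLaw a H F₂ N m)

/-- The empirical measure of a sample of size `n`. -/
def empiricalDist {E : Type*} [MeasurableSpace E] {n : ℕ} (x : Fin n → E) : Measure E :=
  (n : ENNReal)⁻¹ • ∑ i, Measure.dirac (x i)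

/-- The base measure `a / (a + n) • H + n / (a + n) • F_n` of the Dirichlet process posterior. -/
def posteriorBase {E : Type*} [MeasurableSpace E] (a : ℝ) (H : Measure E) {n : ℕ}
    (x : Fin n → E) : Measure E :=
  ENNReal.ofReal (a / (a + n)) • H + ENNReal.ofReal (n / (a + n)) • empiricalDist x

/-- The expectation, given the observed sample `x₁, …, x_n`, of the posterior-based estimator:
the weights are `Dirichlet ((a+n)/N, …, (a+n)/N)` and the atoms are i.i.d. from the posterior base
measure. -/
def expectedPosteriorMMD {E : Type*} [MeasurableSpace E] (k : E → E → ℝ) (a : ℝ)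
    (H F₂ : Measure E) {n : ℕ} (x : Fin n → E) (N m : ℕ) : ℝ :=
  ∫ z, mmdBNP k z.1 z.2.1 z.2.2 ∂(samplingLaw (a + n) (posteriorBase a H x) F₂ N m)

end

/-! Write `φ x = k(x, ·)` for the feature map and `μ_P = ∫ φ dP` for the kernel mean. For fixed
weights summing to one, a bias-variance computation gives the expected estimator as `‖μ_P - μ_Q‖²`,
plus `∑ J_i²` times the variance of `φ` under `P`, plus `1/m` times its variance under `Q`
(`integral_mmdBNP_fixed_weights`). Both variances are bounded because `k` is.

The Dirichlet weights satisfy `E ∑ J_i² ≤ 8/a + 4/N` (`integral_sum_sq_dirichletMeasure_le`), so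
once the total mass, `N` and `m` all tend to infinity only the squared distance of kernel means
survives (`tendsto_integral_mmdBNP`). Universality makes `P ↦ μ_P` injective
(`IsUniversalRKHS.ext_integral_kerFun`), so the limit is zero exactly when the two measures agree.

For the posterior, the kernel mean of the base measure is a convex combination of `μ_H` and the
sample average of `φ`. It tends to `μ_H` as `a → ∞`, and almost surely to `μ_{F₁}` as `n → ∞` by the
strong law in the Hilbert space. -/

/-! ### Moments of the Gamma distribution. -/

theorem gammaMeasure_moment {α : ℝ} (hα : 0 < α) (n : ℕ) :
    Integrable (fun x : ℝ => x ^ n) (gammaMeasure α 1) ∧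
      ∫ x, x ^ n ∂(gammaMeasure α 1) = Real.Gamma (α + n) / Real.Gamma α := by
  have hpos : 0 < α + n := by positivity
  have hmeas : Measurable (gammaPDF α 1) := (measurable_gammaPDFReal α 1).ennreal_ofReal
  have hfin : ∀ᵐ x : ℝ, gammaPDF α 1 x < ⊤ := ae_of_all _ fun _ => ENNReal.ofReal_lt_top
  have heq : ∀ x : ℝ, (gammaPDF α 1 x).toReal • x ^ n =
      (Set.Ici (0 : ℝ)).indicator
        (fun x => (Real.Gamma α)⁻¹ * (x ^ (α - 1) * Real.exp (-x) * x ^ n)) x := by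
    intro x
    rw [gammaPDF, ENNReal.toReal_ofReal (gammaPDFReal_nonneg hα one_pos x), gammaPDFReal]
    by_cases hx : 0 ≤ x
    · simp [hx]; ring
    · simp [hx]
  -- Multiplying the density by `x ^ n` shifts the shape parameter to `α + n`. Merging the powers
  -- needs `x > 0`, hence the later passage from `Ici` to `Ioi`.
  have heq' : ∀ x ∈ Set.Ioi (0 : ℝ),
      (Real.Gamma α)⁻¹ * (Real.exp (-x) * x ^ (α + n - 1)) =
        (Real.Gamma α)⁻¹ * (x ^ (α - 1) * Real.exp (-x) * x ^ n) := by
    intro x hx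
    have hx : 0 < x := hx
    rw [show α + n - 1 = (α - 1) + n by ring, Real.rpow_add hx, Real.rpow_natCast]
    ring
  constructor
  · rw [gammaMeasure, integrable_withDensity_iff_integrable_smul' hmeas hfin]
    simp_rw [heq]
    rw [integrable_indicator_iff measurableSet_Ici, integrableOn_Ici_iff_integrableOn_Ioi]
    exact IntegrableOn.congr_fun ((Real.GammaIntegral_convergent hpos).const_mul _) heq'
      measurableSet_Ioi
  · rw [gammaMeasure, integral_withDensity_eq_integral_toReal_smul hmeas hfin]
    simp_rw [heq]
    rw [integral_indicator measurableSet_Ici, integral_Ici_eq_integral_Ioi,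
      ← setIntegral_congr_fun measurableSet_Ioi heq', integral_const_mul,
      ← Real.Gamma_eq_integral hpos]
    field_simp

theorem integral_gammaMeasure {α : ℝ} (hα : 0 < α) : ∫ x, x ∂(gammaMeasure α 1) = α := by
  have h := (gammaMeasure_moment hα 1).2
  simp only [pow_one, Nat.cast_one, Real.Gamma_add_one hα.ne'] at h
  rw [h, mul_div_cancel_right₀ _ (Real.Gamma_pos_of_pos hα).ne']

theorem integral_sq_gammaMeasure {α : ℝ} (hα : 0 < α) :
    ∫ x, x ^ 2 ∂(gammaMeasure α 1) = α + α ^ 2 := by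
  rw [(gammaMeasure_moment hα 2).2, Nat.cast_ofNat, show α + 2 = α + 1 + 1 by ring,
    Real.Gamma_add_one (by positivity), Real.Gamma_add_one hα.ne']
  field_simp [(Real.Gamma_pos_of_pos hα).ne']
  ring

theorem memLp_id_gammaMeasure {α : ℝ} (hα : 0 < α) :
    MemLp (fun x : ℝ => x) 2 (gammaMeasure α 1) :=
  (memLp_two_iff_integrable_sq measurable_id.aestronglyMeasurable).2 (gammaMeasure_moment hα 2).1

theorem variance_id_gammaMeasure {α : ℝ} (hα : 0 < α) :
    Var[fun x : ℝ => x; gammaMeasure α 1] = α := by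
  have := isProbabilityMeasure_gammaMeasure hα one_pos
  rw [variance_eq_sub (memLp_id_gammaMeasure hα)]
  simp only [Pi.pow_apply, integral_gammaMeasure hα, integral_sq_gammaMeasure hα]
  ring

theorem gammaMeasure_pos_ae (α : ℝ) : ∀ᵐ x ∂(gammaMeasure α 1), 0 < x := by
  rw [ae_iff, gammaMeasure, withDensity_apply _ (by measurability)]
  have h : {x : ℝ | ¬ 0 < x} = Set.Iic 0 := by ext; simp
  rw [h, ← setLIntegral_congr Iio_ae_eq_Iic]
  exact lintegral_gammaPDF_of_nonpos le_rfl

/-! ### Dirichlet weights and their sum of squares. -/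

section Dirichlet

variable {ι : Type*} [Fintype ι]

theorem isProbabilityMeasure_pi_gammaMeasure {α : ι → ℝ} (hα : ∀ i, 0 < α i) :
    IsProbabilityMeasure (Measure.pi fun i => gammaMeasure (α i) 1) := by
  have := fun i => isProbabilityMeasure_gammaMeasure (hα i) one_pos
  infer_instance

theorem measurable_normalize : Measurable fun (g : ι → ℝ) i => g i / ∑ j, g j := by
  fun_prop

theorem isProbabilityMeasure_dirichletMeasure {α : ι → ℝ} (hα : ∀ i, 0 < α i) :
    IsProbabilityMeasure (dirichletMeasure α) := by
  have := isProbabilityMeasure_pi_gammaMeasure hα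
  exact Measure.isProbabilityMeasure_map measurable_normalize.aemeasurable

theorem pi_gammaMeasure_pos_ae {α : ι → ℝ} (hα : ∀ i, 0 < α i) :
    ∀ᵐ g ∂(Measure.pi fun i => gammaMeasure (α i) 1), ∀ i, 0 < g i := by
  have := fun i => isProbabilityMeasure_gammaMeasure (hα i) one_pos
  rw [ae_all_iff]
  intro i
  exact (Measure.quasiMeasurePreserving_eval (fun i => gammaMeasure (α i) 1) i).ae
    (gammaMeasure_pos_ae (α i))

theorem measurableSet_stdSimplex : MeasurableSet (stdSimplex ℝ ι) :=
  (isClosed_stdSimplex ℝ ι).measurableSet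

theorem dirichletMeasure_stdSimplex_ae [Nonempty ι] {α : ι → ℝ} (hα : ∀ i, 0 < α i) :
    ∀ᵐ J ∂(dirichletMeasure α), J ∈ stdSimplex ℝ ι := by
  refine (ae_map_iff (p := (· ∈ stdSimplex ℝ ι)) measurable_normalize.aemeasurable
    measurableSet_stdSimplex).2 ?_
  filter_upwards [pi_gammaMeasure_pos_ae hα] with g hg
  have hs : 0 < ∑ j, g j := Finset.sum_pos (fun j _ => hg j) Finset.univ_nonempty
  refine ⟨fun i => (div_pos (hg i) hs).le, ?_⟩
  rw [← Finset.sum_div, div_self hs.ne']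

/-- Removes the random denominator `s = ∑ g_j`. If `s ≥ a/2`, then `1/s² ≤ 4/a²`. Otherwise the left
side is at most `1`, and `|s - a| ≥ a/2` gives `1 ≤ 4 (s - a)²/a²`. -/
theorem sum_div_sq_le {g : ι → ℝ} {a : ℝ} (ha : 0 < a) (hg : ∀ i, 0 < g i) [Nonempty ι] :
    ∑ i, (g i / ∑ j, g j) ^ 2 ≤ 4 / a ^ 2 * (∑ i, g i ^ 2 + (∑ j, g j - a) ^ 2) := by
  have hs : 0 < ∑ j, g j := Finset.sum_pos (fun j _ => hg j) Finset.univ_nonempty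
  have hsq : ∑ i, g i ^ 2 ≤ (∑ j, g j) ^ 2 :=
    Finset.sum_sq_le_sq_sum_of_nonneg fun i _ => (hg i).le
  have hq : 0 ≤ ∑ i, g i ^ 2 := Finset.sum_nonneg fun i _ => sq_nonneg _
  simp_rw [div_pow]
  rw [← Finset.sum_div]
  generalize ∑ j, g j = s at *
  generalize ∑ i, g i ^ 2 = q at *
  rw [div_mul_eq_mul_div, div_le_div_iff₀ (by positivity) (by positivity)]
  rcases le_total a (2 * s) with h | h
  · have : a ^ 2 ≤ 4 * s ^ 2 := by nlinarith
    nlinarith [mul_le_mul_of_nonneg_left this hq, mul_nonneg (sq_nonneg (s - a)) (sq_nonneg s)]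
  · have : a ^ 2 ≤ 4 * (s - a) ^ 2 := by nlinarith
    nlinarith [mul_le_mul hsq this (sq_nonneg a) (sq_nonneg s), mul_nonneg hq (sq_nonneg s)]

/-- Integrating `sum_div_sq_le` over Gamma variables needs only second moments: `E ∑ g_i² = a +
a²/N` and `Var ∑ g_i = a`. The constants are not sharp, but only decay in `a` and `N` matters. -/
theorem integral_sum_sq_dirichletMeasure_le [Nonempty ι] {a : ℝ} (ha : 0 < a) :
    ∫ J, ∑ i, J i ^ 2 ∂(dirichletMeasure fun _ : ι => a / Fintype.card ι) ≤
      8 / a + 4 / Fintype.card ι := by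
  have hN : (0 : ℝ) < Fintype.card ι := by exact_mod_cast Fintype.card_pos
  set α : ℝ := a / Fintype.card ι with hα_def
  have hα : 0 < α := div_pos ha hN
  have hNα : Fintype.card ι * α = a := by rw [hα_def]; field_simp
  have := isProbabilityMeasure_gammaMeasure hα one_pos
  set μ : Measure (ι → ℝ) := Measure.pi fun _ => gammaMeasure α 1 with hμ
  have hmp := fun i : ι => measurePreserving_eval (fun _ : ι => gammaMeasure α 1) i
  have hmem : ∀ i : ι, MemLp (fun g : ι → ℝ => g i) 2 μ := fun i =>
    (memLp_id_gammaMeasure hα).comp_measurePreserving (hmp i)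
  have hsumMem : MemLp (fun g : ι → ℝ => ∑ i, g i) 2 μ := memLp_finsetSum _ fun i _ => hmem i
  have hmean : ∫ g, ∑ i, g i ∂μ = a := by
    rw [integral_finsetSum _ fun i _ => (hmem i).integrable one_le_two]
    have : ∀ i : ι, ∫ g, g i ∂μ = α := fun i => by
      rw [← integral_gammaMeasure hα]
      exact integral_comp_eval (μ := fun _ : ι => gammaMeasure α 1) (f := fun x : ℝ => x)
        measurable_id.aestronglyMeasurable
    simp [this, hNα]
  have hvar : ∫ g, (∑ i, g i - a) ^ 2 ∂μ = a := by
    have h1 := variance_sum_pi (μ := fun _ : ι => gammaMeasure α 1)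
      (X := fun _ : ι => fun x : ℝ => x) fun _ => memLp_id_gammaMeasure hα
    simp only [variance_id_gammaMeasure hα, Finset.sum_const, Finset.card_univ, nsmul_eq_mul,
      hNα] at h1
    have h2 : (∑ i : ι, fun g : ι → ℝ => g i) = fun g => ∑ i, g i := by ext; simp
    rw [h2, variance_eq_integral hsumMem.aemeasurable, hmean] at h1
    exact h1
  have hsq : ∫ g, ∑ i, g i ^ 2 ∂μ = a + a ^ 2 / Fintype.card ι := by
    rw [integral_finsetSum _ fun i _ => (hmem i).integrable_sq]
    have : ∀ i : ι, ∫ g, g i ^ 2 ∂μ = α + α ^ 2 := fun i => by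
      rw [← integral_sq_gammaMeasure hα]
      exact integral_comp_eval (μ := fun _ : ι => gammaMeasure α 1) (f := fun x : ℝ => x ^ 2)
        (by fun_prop)
    simp only [this, Finset.sum_const, Finset.card_univ, nsmul_eq_mul, hα_def]
    field_simp
  have hint1 : Integrable (fun g : ι → ℝ => ∑ i, g i ^ 2) μ :=
    integrable_finsetSum _ fun i _ => (hmem i).integrable_sq
  have hint2 : Integrable (fun g : ι → ℝ => (∑ i, g i - a) ^ 2) μ :=
    (hsumMem.sub (memLp_const a)).integrable_sq
  calc ∫ J, ∑ i, J i ^ 2 ∂(dirichletMeasure fun _ : ι => α)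
      = ∫ g, ∑ i, (g i / ∑ j, g j) ^ 2 ∂μ :=
        integral_map measurable_normalize.aemeasurable
          (Measurable.aestronglyMeasurable (by fun_prop))
    _ ≤ ∫ g, 4 / a ^ 2 * (∑ i, g i ^ 2 + (∑ j, g j - a) ^ 2) ∂μ := by
        refine integral_mono_of_nonneg (ae_of_all _ fun g => Finset.sum_nonneg fun i _ =>
          sq_nonneg _) ((hint1.add hint2).const_mul _) ?_
        filter_upwards [pi_gammaMeasure_pos_ae fun _ : ι => hα] with g hg
        exact sum_div_sq_le ha hg
    _ = 8 / a + 4 / Fintype.card ι := by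
        rw [integral_const_mul, integral_add hint1 hint2, hvar, hsq]
        field_simp
        ring

end Dirichlet

/-! ### Kernel means and the expectation of the estimator. -/

section KernelMean

variable {E : Type*} {ℋ : Type*} [NormedAddCommGroup ℋ] [InnerProductSpace ℝ ℋ]
  {φ : E → ℋ} {C : ℝ}

theorem abs_inner_feature_le (hC : ∀ x, ‖φ x‖ ≤ C) (x y : E) : |inner ℝ (φ x) (φ y)| ≤ C ^ 2 := by
  refine (abs_real_inner_le_norm _ _).trans ?_
  rw [sq]
  exact mul_le_mul (hC x) (hC y) (norm_nonneg _) ((norm_nonneg _).trans (hC x))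

/-- Serves only to make the estimator integrable. Leaving the constant unsimplified avoids assuming
`m ≠ 0`. -/
theorem abs_mmdBNP_le (hC : ∀ x, ‖φ x‖ ≤ C) {N m : ℕ} {J : Fin N → ℝ}
    (hJ : J ∈ stdSimplex ℝ (Fin N)) (V : Fin N → E) (Y : Fin m → E) :
    |mmdBNP (fun x y => inner ℝ (φ x) (φ y)) J V Y| ≤
      C ^ 2 + |2 / (m : ℝ)| * (m * C ^ 2) + |1 / (m : ℝ) ^ 2| * (m * (m * C ^ 2)) := by
  have hk := abs_inner_feature_le hC
  have h1 : |∑ ℓ, ∑ t, J ℓ * J t * inner ℝ (φ (V ℓ)) (φ (V t))| ≤ C ^ 2 := by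
    calc _ ≤ ∑ ℓ, ∑ t, J ℓ * J t * C ^ 2 :=
          (Finset.abs_sum_le_sum_abs _ _).trans <| Finset.sum_le_sum fun ℓ _ =>
            (Finset.abs_sum_le_sum_abs _ _).trans <| Finset.sum_le_sum fun t _ => by
              rw [abs_mul, abs_of_nonneg (mul_nonneg (hJ.1 ℓ) (hJ.1 t))]
              exact mul_le_mul_of_nonneg_left (hk _ _) (mul_nonneg (hJ.1 ℓ) (hJ.1 t))
      _ = C ^ 2 := by
          simp only [← Finset.sum_mul, ← Finset.mul_sum, hJ.2, one_mul]
  have h2 : |∑ ℓ, ∑ t, J ℓ * inner ℝ (φ (V ℓ)) (φ (Y t))| ≤ m * C ^ 2 := by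
    calc _ ≤ ∑ ℓ, ∑ _t : Fin m, J ℓ * C ^ 2 :=
          (Finset.abs_sum_le_sum_abs _ _).trans <| Finset.sum_le_sum fun ℓ _ =>
            (Finset.abs_sum_le_sum_abs _ _).trans <| Finset.sum_le_sum fun t _ => by
              rw [abs_mul, abs_of_nonneg (hJ.1 ℓ)]
              exact mul_le_mul_of_nonneg_left (hk _ _) (hJ.1 ℓ)
      _ = m * C ^ 2 := by
          simp only [Finset.sum_const, Finset.card_univ, Fintype.card_fin, nsmul_eq_mul,
            ← Finset.mul_sum, ← Finset.sum_mul, hJ.2, one_mul]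
  have h3 : |∑ ℓ, ∑ t, inner ℝ (φ (Y ℓ)) (φ (Y t))| ≤ m * (m * C ^ 2) := by
    calc _ ≤ ∑ _ℓ : Fin m, ∑ _t : Fin m, C ^ 2 :=
          (Finset.abs_sum_le_sum_abs _ _).trans <| Finset.sum_le_sum fun ℓ _ =>
            (Finset.abs_sum_le_sum_abs _ _).trans <| Finset.sum_le_sum fun t _ => hk _ _
      _ = m * (m * C ^ 2) := by simp
  refine (abs_add_le _ _).trans (add_le_add ((abs_sub _ _).trans (add_le_add h1 ?_)) ?_)
  · rw [abs_mul]; gcongr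
  · rw [abs_mul]; gcongr

variable [TopologicalSpace E] [SecondCountableTopology E] [MeasurableSpace E] [BorelSpace E]

theorem integrable_feature {F : Type*} [NormedAddCommGroup F] {φ : E → F} (hφ : Continuous φ)
    (hC : ∀ x, ‖φ x‖ ≤ C) (P : Measure E) [IsFiniteMeasure P] : Integrable φ P :=
  Integrable.of_bound hφ.aestronglyMeasurable C (ae_of_all _ hC)

theorem measurable_inner_feature (hφ : Continuous φ) {Ω : Type*} [MeasurableSpace Ω] {f g : Ω → E}
    (hf : Measurable f) (hg : Measurable g) : Measurable fun ω => inner ℝ (φ (f ω)) (φ (g ω)) :=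
  (((hφ.comp continuous_fst).inner (hφ.comp continuous_snd)).measurable).comp (hf.prodMk hg)

theorem integrable_inner_feature (hφ : Continuous φ) (hC : ∀ x, ‖φ x‖ ≤ C) {Ω : Type*}
    [MeasurableSpace Ω] (μ : Measure Ω) [IsFiniteMeasure μ] {f g : Ω → E}
    (hf : Measurable f) (hg : Measurable g) :
    Integrable (fun ω => inner ℝ (φ (f ω)) (φ (g ω))) μ :=
  Integrable.of_bound (measurable_inner_feature hφ hf hg).aestronglyMeasurable (C ^ 2)
    (ae_of_all _ fun _ => abs_inner_feature_le hC _ _)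

/-- For independent `f` and `g`, the mean of the kernel is the inner product of the kernel means. -/
theorem integral_inner_feature [CompleteSpace ℋ] (hφ : Continuous φ) (hC : ∀ x, ‖φ x‖ ≤ C)
    {Ω : Type*} [MeasurableSpace Ω] {μ : Measure Ω} {P Q : Measure E} [IsProbabilityMeasure P]
    [IsProbabilityMeasure Q] {f g : Ω → E} (hf : Measurable f) (hg : Measurable g)
    (h : μ.map (fun ω => (f ω, g ω)) = P.prod Q) :
    ∫ ω, inner ℝ (φ (f ω)) (φ (g ω)) ∂μ = inner ℝ (∫ x, φ x ∂P) (∫ x, φ x ∂Q) := by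
  have h1 : ∫ ω, inner ℝ (φ (f ω)) (φ (g ω)) ∂μ = ∫ z, inner ℝ (φ z.1) (φ z.2) ∂(P.prod Q) := by
    rw [← h, integral_map (hf.prodMk hg).aemeasurable
      (measurable_inner_feature hφ measurable_fst measurable_snd).aestronglyMeasurable]
  rw [h1, integral_prod _ (integrable_inner_feature hφ hC _ measurable_fst measurable_snd)]
  have h2 : ∀ x, ∫ y, inner ℝ (φ x) (φ y) ∂Q = inner ℝ (∫ y, φ y ∂Q) (φ x) := fun x => by
    rw [integral_inner (integrable_feature hφ hC Q), real_inner_comm]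
  simp only [h2]
  rw [integral_inner (integrable_feature hφ hC P), real_inner_comm]

/-- The mean over an i.i.d. sample from `P` of the kernel at two of its points. -/
theorem integral_pi_inner_feature [CompleteSpace ℋ] (hφ : Continuous φ) (hC : ∀ x, ‖φ x‖ ≤ C)
    {ι : Type*} [Fintype ι] [DecidableEq ι] (P : Measure E) [IsProbabilityMeasure P] (i j : ι) :
    ∫ v, inner ℝ (φ (v i)) (φ (v j)) ∂(Measure.pi fun _ : ι => P) =
      if i = j then ∫ x, ‖φ x‖ ^ 2 ∂P else ‖∫ x, φ x ∂P‖ ^ 2 := by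
  split_ifs with hij
  · subst hij
    simp only [real_inner_self_eq_norm_sq]
    exact integral_comp_eval (μ := fun _ : ι => P) (f := fun x => ‖φ x‖ ^ 2)
      (hφ.norm.pow 2).aestronglyMeasurable
  · rw [← real_inner_self_eq_norm_sq]
    refine integral_inner_feature hφ hC (measurable_pi_apply i) (measurable_pi_apply j) ?_
    have hind := (iIndepFun_pi (μ := fun _ : ι => P) (X := fun _ x => x)
      fun _ => aemeasurable_id).indepFun hij
    rw [(indepFun_iff_map_prod_eq_prod_map_map (measurable_pi_apply i).aemeasurable
      (measurable_pi_apply j).aemeasurable).1 hind]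
    congr 1
    · exact (measurePreserving_eval (fun _ : ι => P) i).map_eq
    · exact (measurePreserving_eval (fun _ : ι => P) j).map_eq

/-- The diagonal excess `s - q` is what becomes the variance term. -/
theorem sum_sum_mul_ite {ι : Type*} [Fintype ι] [DecidableEq ι] (J : ι → ℝ) (s q : ℝ) :
    ∑ i, ∑ j, J i * J j * (if i = j then s else q) =
      (∑ i, J i) ^ 2 * q + (∑ i, J i ^ 2) * (s - q) := by
  have h : ∀ i j, J i * J j * (if i = j then s else q) =
      J i * J j * q + if i = j then J i * J j * (s - q) else 0 := by
    intro i j; split_ifs <;> ring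
  simp only [h, Finset.sum_add_distrib, Finset.sum_ite_eq, Finset.mem_univ, if_true,
    ← Finset.sum_mul, sq, Finset.sum_mul_sum]

theorem measurable_mmdBNP (hφ : Continuous φ) (N m : ℕ) :
    Measurable fun z : (Fin N → ℝ) × (Fin N → E) × (Fin m → E) =>
      mmdBNP (fun x y => inner ℝ (φ x) (φ y)) z.1 z.2.1 z.2.2 := by
  have hVV := fun i j => measurable_inner_feature hφ
    (f := fun z : (Fin N → ℝ) × (Fin N → E) × (Fin m → E) => z.2.1 i) (g := fun z => z.2.1 j)
    (by fun_prop) (by fun_prop)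
  have hVY := fun i j => measurable_inner_feature hφ
    (f := fun z : (Fin N → ℝ) × (Fin N → E) × (Fin m → E) => z.2.1 i) (g := fun z => z.2.2 j)
    (by fun_prop) (by fun_prop)
  have hYY := fun i j => measurable_inner_feature hφ
    (f := fun z : (Fin N → ℝ) × (Fin N → E) × (Fin m → E) => z.2.2 i) (g := fun z => z.2.2 j)
    (by fun_prop) (by fun_prop)
  unfold mmdBNP
  fun_prop

variable [CompleteSpace ℋ]

/-- The expectation of the estimator for fixed weights. -/
theorem integral_mmdBNP_fixed_weights (hφ : Continuous φ) (hC : ∀ x, ‖φ x‖ ≤ C)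
    (P Q : Measure E) [IsProbabilityMeasure P] [IsProbabilityMeasure Q] {N m : ℕ} (hm : m ≠ 0)
    {J : Fin N → ℝ} (hJ : ∑ i, J i = 1) :
    ∫ z, mmdBNP (fun x y => inner ℝ (φ x) (φ y)) J z.1 z.2
        ∂((Measure.pi fun _ : Fin N => P).prod (Measure.pi fun _ : Fin m => Q)) =
      ‖∫ x, φ x ∂P - ∫ x, φ x ∂Q‖ ^ 2
        + (∑ i, J i ^ 2) * (∫ x, ‖φ x‖ ^ 2 ∂P - ‖∫ x, φ x ∂P‖ ^ 2)
        + 1 / m * (∫ x, ‖φ x‖ ^ 2 ∂Q - ‖∫ x, φ x ∂Q‖ ^ 2) := by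
  set μ := (Measure.pi fun _ : Fin N => P).prod (Measure.pi fun _ : Fin m => Q) with hμ
  have mV : ∀ i, Measurable fun z : (Fin N → E) × (Fin m → E) => z.1 i := fun i => by fun_prop
  have mY : ∀ i, Measurable fun z : (Fin N → E) × (Fin m → E) => z.2 i := fun i => by fun_prop
  have iVV := fun i j => integrable_inner_feature hφ hC μ (mV i) (mV j)
  have iVY := fun i j => integrable_inner_feature hφ hC μ (mV i) (mY j)
  have iYY := fun i j => integrable_inner_feature hφ hC μ (mY i) (mY j)
  have eVV : ∀ i j, ∫ z, inner ℝ (φ (z.1 i)) (φ (z.1 j)) ∂μ =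
      if i = j then ∫ x, ‖φ x‖ ^ 2 ∂P else ‖∫ x, φ x ∂P‖ ^ 2 := fun i j => by
    rw [← integral_pi_inner_feature hφ hC P i j,
      ← (measurePreserving_fst (μ := Measure.pi fun _ : Fin N => P)
        (ν := Measure.pi fun _ : Fin m => Q)).map_eq,
      integral_map measurable_fst.aemeasurable (measurable_inner_feature hφ
        (measurable_pi_apply i) (measurable_pi_apply j)).aestronglyMeasurable]
  have eYY : ∀ i j, ∫ z, inner ℝ (φ (z.2 i)) (φ (z.2 j)) ∂μ =
      if i = j then ∫ x, ‖φ x‖ ^ 2 ∂Q else ‖∫ x, φ x ∂Q‖ ^ 2 := fun i j => by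
    rw [← integral_pi_inner_feature hφ hC Q i j,
      ← (measurePreserving_snd (μ := Measure.pi fun _ : Fin N => P)
        (ν := Measure.pi fun _ : Fin m => Q)).map_eq,
      integral_map measurable_snd.aemeasurable (measurable_inner_feature hφ
        (measurable_pi_apply i) (measurable_pi_apply j)).aestronglyMeasurable]
  have eVY : ∀ i j, ∫ z, inner ℝ (φ (z.1 i)) (φ (z.2 j)) ∂μ =
      inner ℝ (∫ x, φ x ∂P) (∫ x, φ x ∂Q) := fun i j =>
    integral_inner_feature hφ hC (mV i) (mY j)
      ((measurePreserving_eval (fun _ : Fin N => P) i).prod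
        (measurePreserving_eval (fun _ : Fin m => Q) j)).map_eq
  have hm' : (m : ℝ) ≠ 0 := Nat.cast_ne_zero.2 hm
  -- The `Y` double sum is the same identity with unit weights, so its diagonal contributes `m`,
  -- which the factor `1/m²` turns into `1/m`.
  have hY := sum_sum_mul_ite (fun _ : Fin m => (1 : ℝ)) (∫ x, ‖φ x‖ ^ 2 ∂Q) (‖∫ x, φ x ∂Q‖ ^ 2)
  simp only [one_mul, Finset.sum_const, Finset.card_univ, Fintype.card_fin, nsmul_eq_mul,
    mul_one, one_pow] at hY
  simp only [mmdBNP]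
  rw [integral_add, integral_sub, integral_const_mul, integral_const_mul,
    integral_finsetSum, integral_finsetSum, integral_finsetSum]
  · simp only [integral_finsetSum _ fun j _ => (iVV _ j).const_mul _,
      integral_finsetSum _ fun j _ => (iVY _ j).const_mul _,
      integral_finsetSum _ fun j _ => iYY _ j, integral_const_mul, eVV, eVY, eYY]
    rw [sum_sum_mul_ite, hY, hJ, norm_sub_sq_real]
    simp only [Finset.sum_const, Finset.card_univ, Fintype.card_fin, nsmul_eq_mul]
    rw [← Finset.mul_sum, ← Finset.sum_mul, hJ]
    field_simp
    ring
  · exact fun i _ => integrable_finsetSum _ fun j _ => iYY i j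
  · exact fun i _ => integrable_finsetSum _ fun j _ => (iVY i j).const_mul _
  · exact fun i _ => integrable_finsetSum _ fun j _ => (iVV i j).const_mul _
  · exact integrable_finsetSum _ fun i _ => integrable_finsetSum _ fun j _ =>
      (iVV i j).const_mul _
  · exact (integrable_finsetSum _ fun i _ => integrable_finsetSum _ fun j _ =>
      (iVY i j).const_mul _).const_mul _
  · exact (integrable_finsetSum _ fun i _ => integrable_finsetSum _ fun j _ =>
      (iVV i j).const_mul _).sub ((integrable_finsetSum _ fun i _ => integrable_finsetSum _
        fun j _ => (iVY i j).const_mul _).const_mul _)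
  · exact (integrable_finsetSum _ fun i _ => integrable_finsetSum _ fun j _ =>
      iYY i j).const_mul _

theorem integral_mmdBNP_samplingLaw (hφ : Continuous φ) (hC : ∀ x, ‖φ x‖ ≤ C)
    (P Q : Measure E) [IsProbabilityMeasure P] [IsProbabilityMeasure Q] {N m : ℕ} (hN : N ≠ 0)
    (hm : m ≠ 0) {a : ℝ} (ha : 0 < a) :
    ∫ z, mmdBNP (fun x y => inner ℝ (φ x) (φ y)) z.1 z.2.1 z.2.2 ∂(samplingLaw a P Q N m) =
      ‖∫ x, φ x ∂P - ∫ x, φ x ∂Q‖ ^ 2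
        + (∫ J, ∑ i, J i ^ 2 ∂(dirichletMeasure fun _ : Fin N => a / N)) *
          (∫ x, ‖φ x‖ ^ 2 ∂P - ‖∫ x, φ x ∂P‖ ^ 2)
        + 1 / m * (∫ x, ‖φ x‖ ^ 2 ∂Q - ‖∫ x, φ x ∂Q‖ ^ 2) := by
  have : Nonempty (Fin N) := Fin.pos_iff_nonempty.1 (Nat.pos_of_ne_zero hN)
  have hα : ∀ _ : Fin N, 0 < a / N := fun _ =>
    div_pos ha (Nat.cast_pos.2 (Nat.pos_of_ne_zero hN))
  have := isProbabilityMeasure_dirichletMeasure hα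
  have hsimplex := dirichletMeasure_stdSimplex_ae hα
  have hint : Integrable (fun z : (Fin N → ℝ) × (Fin N → E) × (Fin m → E) =>
      mmdBNP (fun x y => inner ℝ (φ x) (φ y)) z.1 z.2.1 z.2.2) (samplingLaw a P Q N m) := by
    unfold samplingLaw
    refine Integrable.of_bound (measurable_mmdBNP hφ N m).aestronglyMeasurable
      (C ^ 2 + |2 / (m : ℝ)| * (m * C ^ 2) + |1 / (m : ℝ) ^ 2| * (m * (m * C ^ 2))) ?_
    filter_upwards [Measure.quasiMeasurePreserving_fst.ae hsimplex] with z hz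
    exact abs_mmdBNP_le hC hz _ _
  have hsq : Integrable (fun J : Fin N → ℝ => ∑ i, J i ^ 2)
      (dirichletMeasure fun _ : Fin N => a / N) := by
    refine Integrable.of_bound (Measurable.aestronglyMeasurable (by fun_prop)) 1 ?_
    filter_upwards [hsimplex] with J hJ
    rw [Real.norm_of_nonneg (Finset.sum_nonneg fun i _ => sq_nonneg _)]
    calc ∑ i, J i ^ 2 ≤ (∑ i, J i) ^ 2 :=
          Finset.sum_sq_le_sq_sum_of_nonneg fun i _ => hJ.1 i
      _ = 1 := by rw [hJ.2, one_pow]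
  unfold samplingLaw at hint ⊢
  -- Fubini conditions on `J`; the fixed-weight formula applies because `J` lies in the simplex
  -- almost surely.
  rw [integral_prod _ hint, integral_congr_ae (hsimplex.mono fun J hJ =>
    integral_mmdBNP_fixed_weights hφ hC P Q hm hJ.2), integral_add, integral_add,
    integral_mul_const]
  · simp
  · exact integrable_const _
  · exact hsq.mul_const _
  · exact (integrable_const _).add (hsq.mul_const _)
  · exact integrable_const _

theorem abs_integral_mmdBNP_sub_le (hφ : Continuous φ) (hC : ∀ x, ‖φ x‖ ≤ C)
    (P Q : Measure E) [IsProbabilityMeasure P] [IsProbabilityMeasure Q] {N m : ℕ} (hN : N ≠ 0)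
    (hm : m ≠ 0) {a : ℝ} (ha : 0 < a) :
    |∫ z, mmdBNP (fun x y => inner ℝ (φ x) (φ y)) z.1 z.2.1 z.2.2 ∂(samplingLaw a P Q N m) -
      ‖∫ x, φ x ∂P - ∫ x, φ x ∂Q‖ ^ 2| ≤ (8 / a + 4 / N + 1 / m) * C ^ 2 := by
  have : Nonempty (Fin N) := Fin.pos_iff_nonempty.1 (Nat.pos_of_ne_zero hN)
  have hvar : ∀ (ν : Measure E) [IsProbabilityMeasure ν],
      |∫ x, ‖φ x‖ ^ 2 ∂ν - ‖∫ x, φ x ∂ν‖ ^ 2| ≤ C ^ 2 := by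
    intro ν _
    have hC0 : ∀ x, ‖φ x‖ ^ 2 ≤ C ^ 2 := fun x => pow_le_pow_left₀ (norm_nonneg _) (hC x) 2
    have h1 : ∫ x, ‖φ x‖ ^ 2 ∂ν ≤ C ^ 2 := by
      refine (integral_mono_of_nonneg (ae_of_all _ fun x => sq_nonneg _) (integrable_const (C ^ 2))
        (ae_of_all _ hC0)).trans_eq (by simp)
    have h2 : ‖∫ x, φ x ∂ν‖ ^ 2 ≤ C ^ 2 := by
      refine pow_le_pow_left₀ (norm_nonneg _) ?_ 2
      simpa using norm_integral_le_of_norm_le_const (μ := ν) (ae_of_all _ hC)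
    have h3 : 0 ≤ ∫ x, ‖φ x‖ ^ 2 ∂ν := integral_nonneg fun x => sq_nonneg _
    -- Both terms lie in `[0, C ^ 2]`, so their difference is bounded by `C ^ 2`.
    rw [abs_le]
    constructor <;> nlinarith [sq_nonneg ‖∫ x, φ x ∂ν‖]
  have hc := integral_sum_sq_dirichletMeasure_le (ι := Fin N) ha
  rw [Fintype.card_fin] at hc
  have hc0 : 0 ≤ ∫ J, ∑ i, J i ^ 2 ∂(dirichletMeasure fun _ : Fin N => a / N) :=
    integral_nonneg fun J => Finset.sum_nonneg fun i _ => sq_nonneg _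
  rw [integral_mmdBNP_samplingLaw hφ hC P Q hN hm ha, add_assoc, add_sub_cancel_left, add_mul]
  refine (abs_add_le _ _).trans (add_le_add ?_ ?_)
  · rw [abs_mul, abs_of_nonneg hc0]
    exact mul_le_mul hc (hvar P) (abs_nonneg _) (hc0.trans hc)
  · rw [abs_mul, abs_of_nonneg (by positivity)]
    exact mul_le_mul_of_nonneg_left (hvar Q) (by positivity)

/-- The expected estimator converges to the squared distance of the kernel means. -/
theorem tendsto_integral_mmdBNP (hφ : Continuous φ) (hC : ∀ x, ‖φ x‖ ≤ C) {β : Type*}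
    {l : Filter β} {a : β → ℝ} {N m : β → ℕ} {P : β → Measure E} {v : ℋ} (Q : Measure E)
    [IsProbabilityMeasure Q] (ha : Tendsto a l atTop) (hN : Tendsto N l atTop)
    (hm : Tendsto m l atTop) (hP : ∀ᶠ b in l, IsProbabilityMeasure (P b))
    (hv : Tendsto (fun b => ∫ x, φ x ∂(P b)) l (𝓝 v)) :
    Tendsto (fun b => ∫ z, mmdBNP (fun x y => inner ℝ (φ x) (φ y)) z.1 z.2.1 z.2.2
      ∂(samplingLaw (a b) (P b) Q (N b) (m b))) l (𝓝 (‖v - ∫ x, φ x ∂Q‖ ^ 2)) := by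
  have hN' : Tendsto (fun b => (N b : ℝ)) l atTop := tendsto_natCast_atTop_atTop.comp hN
  have hm' : Tendsto (fun b => (m b : ℝ)) l atTop := tendsto_natCast_atTop_atTop.comp hm
  have hbound : Tendsto (fun b => (8 / a b + 4 / N b + 1 / m b) * C ^ 2) l (𝓝 0) := by
    simpa using ((((ha.const_div_atTop 8).add (hN'.const_div_atTop 4)).add
      (hm'.const_div_atTop 1)).mul_const (C ^ 2))
  have hdiff : Tendsto (fun b => ∫ z, mmdBNP (fun x y => inner ℝ (φ x) (φ y)) z.1 z.2.1 z.2.2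
      ∂(samplingLaw (a b) (P b) Q (N b) (m b)) - ‖∫ x, φ x ∂(P b) - ∫ x, φ x ∂Q‖ ^ 2) l (𝓝 0) := by
    refine squeeze_zero_norm' ?_ hbound
    filter_upwards [ha.eventually_gt_atTop 0, hN.eventually_ne_atTop 0, hm.eventually_ne_atTop 0,
      hP] with b hab hNb hmb hPb
    exact abs_integral_mmdBNP_sub_le hφ hC (P b) Q hNb hmb hab
  simpa using hdiff.add ((hv.sub_const (∫ x, φ x ∂Q)).norm.pow 2)

end KernelMean

/-! ### The posterior base measure and its kernel mean. -/

section Posterior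

variable {E : Type*} [MeasurableSpace E]

theorem isProbabilityMeasure_empiricalDist {n : ℕ} (hn : n ≠ 0) (x : Fin n → E) :
    IsProbabilityMeasure (empiricalDist x) where
  measure_univ := by
    simp [empiricalDist, ENNReal.inv_mul_cancel (Nat.cast_ne_zero.2 hn) (ENNReal.natCast_ne_top n)]

theorem isProbabilityMeasure_posteriorBase {a : ℝ} (ha : 0 ≤ a) (H : Measure E)
    [IsProbabilityMeasure H] {n : ℕ} (x : Fin n → E) (h : 0 < a + n) :
    IsProbabilityMeasure (posteriorBase a H x) where
  measure_univ := by
    -- For the empty sample `empiricalDist x` is the zero measure, and the posterior base reduces to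
    -- `H`.
    rcases eq_or_ne n 0 with rfl | hn
    · have : a / a = 1 := div_self (by simpa using h.ne')
      simp [posteriorBase, this]
    · have := isProbabilityMeasure_empiricalDist hn x
      simp only [posteriorBase, Measure.coe_add, Measure.coe_smul, Pi.add_apply, Pi.smul_apply,
        measure_univ, smul_eq_mul, mul_one]
      rw [← ENNReal.ofReal_add (by positivity) (by positivity), ← add_div, div_self h.ne',
        ENNReal.ofReal_one]

variable [TopologicalSpace E] [SecondCountableTopology E] [BorelSpace E] {F : Type*}
  [NormedAddCommGroup F]

theorem integrable_empiricalDist {φ : E → F} {C : ℝ} (hφ : Continuous φ)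
    (hC : ∀ x, ‖φ x‖ ≤ C) {n : ℕ} (hn : n ≠ 0) (x : Fin n → E) : Integrable φ (empiricalDist x) := by
  have := isProbabilityMeasure_empiricalDist hn x
  exact integrable_feature hφ hC _

variable [NormedSpace ℝ F] [CompleteSpace F]

theorem integral_empiricalDist
    {φ : E → F} {C : ℝ} (hφ : Continuous φ) (hC : ∀ x, ‖φ x‖ ≤ C) {n : ℕ} (x : Fin n → E) :
    ∫ y, φ y ∂(empiricalDist x) = (n : ℝ)⁻¹ • ∑ i, φ (x i) := by
  rw [empiricalDist, integral_smul_measure, integral_finsetSum_measure fun i _ =>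
    integrable_feature hφ hC _]
  simp [integral_dirac' _ _ hφ.stronglyMeasurable]

theorem integral_posteriorBase
    {φ : E → F} {C : ℝ} (hφ : Continuous φ) (hC : ∀ x, ‖φ x‖ ≤ C) {a : ℝ} (ha : 0 ≤ a)
    (H : Measure E) [IsProbabilityMeasure H] {n : ℕ} (x : Fin n → E) :
    ∫ y, φ y ∂(posteriorBase a H x) = (a / (a + n)) • ∫ y, φ y ∂H +
      (n / (a + n)) • (n : ℝ)⁻¹ • ∑ i, φ (x i) := by
  have h1 : 0 ≤ a / (a + n) := by positivity
  have h2 : 0 ≤ n / (a + n) := by positivity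
  rcases eq_or_ne n 0 with rfl | hn
  · simp [posteriorBase, integral_smul_measure, ENNReal.toReal_ofReal (div_nonneg ha ha)]
  · rw [posteriorBase, integral_add_measure
      ((integrable_feature hφ hC H).smul_measure ENNReal.ofReal_ne_top)
      ((integrable_empiricalDist hφ hC hn x).smul_measure ENNReal.ofReal_ne_top),
      integral_smul_measure, integral_smul_measure, integral_empiricalDist hφ hC,
      ENNReal.toReal_ofReal h1, ENNReal.toReal_ofReal h2]

end Posterior

/-! ### The canonical feature map and injectivity of the mean embedding. -/

section RKHS

variable {E : Type*} {ℋ : Type*} [NormedAddCommGroup ℋ] [InnerProductSpace ℝ ℋ] [CompleteSpace ℋ]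
  [RKHS ℝ ℋ E ℝ] {k : E → E → ℝ}

theorem IsReproducingKernelOf.eq_inner (hk : IsReproducingKernelOf k ℋ) (x y : E) :
    k x y = inner ℝ (RKHS.kerFun ℋ x 1) (RKHS.kerFun ℋ y 1) := by
  rw [hk x y, RKHS.inner_kerFun, RKHS.kerFun_apply, ← RKHS.kerFun_apply, ← RKHS.kerFun_apply]
  have h := real_inner_comm (RKHS.kerFun ℋ x (1 : ℝ)) (RKHS.kerFun ℋ y 1)
  simpa using h

theorem IsReproducingKernelOf.norm_kerFun_sq (hk : IsReproducingKernelOf k ℋ) (x : E) :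
    ‖RKHS.kerFun ℋ x (1 : ℝ)‖ ^ 2 = k x x := by
  rw [hk.eq_inner, real_inner_self_eq_norm_sq]

/-- Follows from `‖φ y - φ x‖² = k y y - 2 k y x + k x x`, which is continuous in `y` and vanishes
at `y = x`. -/
theorem IsReproducingKernelOf.continuous_kerFun [TopologicalSpace E]
    (hk : IsReproducingKernelOf k ℋ) (hcont : Continuous fun p : E × E => k p.1 p.2) :
    Continuous fun x => RKHS.kerFun ℋ x (1 : ℝ) := by
  rw [continuous_iff_continuousAt]
  intro x
  have hsq : ∀ y, ‖RKHS.kerFun ℋ y (1 : ℝ) - RKHS.kerFun ℋ x 1‖ =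
      √(k y y - 2 * k y x + k x x) := fun y => by
    rw [← hk.norm_kerFun_sq, ← hk.norm_kerFun_sq, hk.eq_inner, ← norm_sub_sq_real,
      Real.sqrt_sq (norm_nonneg _)]
  rw [ContinuousAt, tendsto_iff_norm_sub_tendsto_zero]
  simp only [hsq]
  have h1 : Continuous fun y => k y y := hcont.comp (continuous_id.prodMk continuous_id)
  have h2 : Continuous fun y => k y x := hcont.comp (continuous_id.prodMk continuous_const)
  have h3 : Continuous fun y => √(k y y - 2 * k y x + k x x) := by fun_prop
  have h4 := h3.tendsto x
  rwa [show k x x - 2 * k x x + k x x = 0 by ring, Real.sqrt_zero] at h4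

/-- The kernel mean embedding of a universal reproducing kernel Hilbert space is injective. -/
theorem IsUniversalRKHS.ext_integral_kerFun [TopologicalSpace E] [T2Space E]
    [LocallyCompactSpace E] [SecondCountableTopology E] [MeasurableSpace E] [BorelSpace E]
    (huniv : IsUniversalRKHS ℋ (E := E)) {P Q : Measure E} [IsProbabilityMeasure P]
    [IsProbabilityMeasure Q] [P.Regular] [Q.Regular]
    (hφ : Continuous fun x : E => RKHS.kerFun ℋ x (1 : ℝ)) {C : ℝ}
    (hC : ∀ x : E, ‖RKHS.kerFun ℋ x (1 : ℝ)‖ ≤ C)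
    (h : ∫ x, RKHS.kerFun ℋ x (1 : ℝ) ∂P = ∫ x, RKHS.kerFun ℋ x (1 : ℝ) ∂Q) : P = Q := by
  have hcoe : ∀ (g : ℋ) (x : E), g x = inner ℝ g (RKHS.kerFun ℋ x (1 : ℝ)) := fun g x => by simp
  have hgi : ∀ (g : ℋ) (ν : Measure E) [IsProbabilityMeasure ν], Integrable (fun x => g x) ν :=
    fun g ν _ => by
      simp only [hcoe]
      exact (integrable_feature hφ hC ν).const_inner g
  have hg : ∀ g : ℋ, ∫ x, g x ∂P = ∫ x, g x ∂Q := fun g => by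
    simp only [hcoe]
    rw [integral_inner (integrable_feature hφ hC P), integral_inner (integrable_feature hφ hC Q), h]
  -- Regular measures are determined by compactly supported continuous test functions. These vanish
  -- at infinity, so universality approximates them by elements of `ℋ`, on which `P` and `Q` already
  -- agree.
  refine Measure.ext_of_integral_eq_on_compactlySupported fun f => ?_
  have hfi : ∀ (ν : Measure E) [IsProbabilityMeasure ν], Integrable f ν := fun ν _ =>
    f.continuous.integrable_of_hasCompactSupport f.hasCompactSupport
  refine eq_of_abs_sub_le_all fun ε hε => ?_
  obtain ⟨g, hgε⟩ := huniv ⟨f.toContinuousMap, f.hasCompactSupport.is_zero_at_infty⟩ (ε / 2)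
    (half_pos hε)
  have hclose : ∀ (ν : Measure E) [IsProbabilityMeasure ν],
      |∫ x, f x ∂ν - ∫ x, g x ∂ν| ≤ ε / 2 := fun ν _ => by
    rw [← integral_sub (hfi ν) (hgi g ν)]
    simpa using norm_integral_le_of_norm_le_const (μ := ν) (f := fun x => f x - g x)
      (ae_of_all _ fun x => (hgε x).le)
  have hP := hclose P
  have hQ := hclose Q
  rw [hg g] at hP
  rw [abs_sub_comm] at hQ
  linarith [abs_sub_le (∫ x, f x ∂P) (∫ x, g x ∂Q) (∫ x, f x ∂Q)]

end RKHS

/-! ### Almost sure convergence and the main theorem. -/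

/-- The strong law of large numbers for a bounded continuous feature map. -/
theorem strong_law_ae_feature {E ℋ Ω : Type*} [TopologicalSpace E] [SecondCountableTopology E]
    [MeasurableSpace E] [BorelSpace E] [NormedAddCommGroup ℋ] [NormedSpace ℝ ℋ] [CompleteSpace ℋ]
    {φ : E → ℋ} {C : ℝ} (hφ : Continuous φ) (hC : ∀ x, ‖φ x‖ ≤ C) [MeasurableSpace Ω]
    {P : Measure Ω} {F : Measure E} [IsProbabilityMeasure F] {X : ℕ → Ω → E}
    (hX : ∀ i, Measurable (X i)) (hlaw : ∀ i, P.map (X i) = F) (hind : iIndepFun X P) :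
    ∀ᵐ ω ∂P, Tendsto (fun n : ℕ => (n : ℝ)⁻¹ • ∑ i : Fin n, φ (X i ω)) atTop
      (𝓝 (∫ x, φ x ∂F)) := by
  borelize ℋ
  have hint : Integrable (fun ω => φ (X 0 ω)) P := by
    have := integrable_feature hφ hC F
    rw [← hlaw 0] at this
    exact this.comp_measurable (hX 0)
  have hlln := strong_law_ae (μ := P) (fun i ω => φ (X i ω)) hint
    (fun i j hij => (hind.indepFun hij).comp hφ.measurable hφ.measurable)
    (fun i => IdentDistrib.comp ⟨(hX i).aemeasurable, (hX 0).aemeasurable, by rw [hlaw, hlaw]⟩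
      hφ.measurable)
  rw [← hlaw 0, integral_map (hX 0).aemeasurable hφ.aestronglyMeasurable]
  filter_upwards [hlln] with ω hω
  simpa only [Finset.sum_range] using hω

theorem tendsto_nhds_zero_iff_of_tendsto_norm_sub_sq {F β : Type*} [NormedAddCommGroup F]
    {l : Filter β} [l.NeBot] {f : β → ℝ} {v w : F} (h : Tendsto f l (𝓝 (‖v - w‖ ^ 2))) :
    Tendsto f l (𝓝 0) ↔ v = w := by
  constructor
  · intro h0
    have := tendsto_nhds_unique h h0
    rwa [sq_eq_zero_iff, norm_sub_eq_zero_iff] at this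
  · rintro rfl
    simpa using h

theorem corollary3 {d : ℕ}
    (ℋ : Type*) [NormedAddCommGroup ℋ] [InnerProductSpace ℝ ℋ] [CompleteSpace ℋ]
    [RKHS ℝ ℋ (EuclideanSpace ℝ (Fin d)) ℝ]
    (k : EuclideanSpace ℝ (Fin d) → EuclideanSpace ℝ (Fin d) → ℝ)
    (hk : IsReproducingKernelOf k ℋ)
    (hcont : Continuous fun p : EuclideanSpace ℝ (Fin d) × EuclideanSpace ℝ (Fin d) => k p.1 p.2)
    (huniv : IsUniversalRKHS ℋ)
    (K : ℝ) (hK : ∀ z z', |k z z'| < K)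
    (H F₁ F₂ : Measure (EuclideanSpace ℝ (Fin d)))
    [IsProbabilityMeasure H] [IsProbabilityMeasure F₁] [IsProbabilityMeasure F₂] :
    -- the informative prior limit, for the prior-based estimator
    (Tendsto (fun p : ℝ × ℕ × ℕ => expectedPriorMMD k p.1 H F₂ p.2.1 p.2.2)
        (atTop ×ˢ atTop ×ˢ atTop) (𝓝 0) ↔ H = F₂) ∧
    -- the informative prior limit, for the posterior-based estimator given any fixed sample
    (∀ (n : ℕ) (x : Fin n → EuclideanSpace ℝ (Fin d)),
      Tendsto (fun p : ℝ × ℕ × ℕ => expectedPosteriorMMD k p.1 H F₂ x p.2.1 p.2.2)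
        (atTop ×ˢ atTop ×ˢ atTop) (𝓝 0) ↔ H = F₂) ∧
    -- consistency: almost surely along an i.i.d. sequence from `F₁`, as `N, n, m → ∞`
    (∀ (Ω : Type*) [MeasurableSpace Ω] (P : Measure Ω) [IsProbabilityMeasure P]
      (X : ℕ → Ω → EuclideanSpace ℝ (Fin d)),
      (∀ i, Measurable (X i)) → (∀ i, P.map (X i) = F₁) → iIndepFun X P →
      ∀ a : ℝ, 0 ≤ a → ∀ᵐ ω ∂P,
        (Tendsto (fun p : ℕ × ℕ × ℕ =>
            expectedPosteriorMMD k a H F₂ (fun i : Fin p.2.1 => X i ω) p.1 p.2.2)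
          (atTop ×ˢ atTop ×ˢ atTop) (𝓝 0) ↔ F₁ = F₂)) := by
  obtain rfl : k = fun x y => inner ℝ (RKHS.kerFun ℋ x (1 : ℝ)) (RKHS.kerFun ℋ y 1) :=
    funext₂ hk.eq_inner
  set φ : EuclideanSpace ℝ (Fin d) → ℋ := fun x => RKHS.kerFun ℋ x (1 : ℝ) with hφ_def
  have hφ : Continuous φ := hk.continuous_kerFun hcont
  -- The bound on the diagonal suffices, since `‖φ x‖² = k x x`.
  have hC : ∀ x, ‖φ x‖ ≤ √K := fun x => Real.le_sqrt_of_sq_le <| by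
    rw [hk.norm_kerFun_sq]
    exact (le_abs_self _).trans (hK x x).le
  have hinj : ∀ (P Q : Measure (EuclideanSpace ℝ (Fin d))) [IsProbabilityMeasure P]
      [IsProbabilityMeasure Q], ∫ x, φ x ∂P = ∫ x, φ x ∂Q ↔ P = Q := fun P Q _ _ =>
    ⟨huniv.ext_integral_kerFun hφ hC, fun h => by rw [h]⟩
  have hfst : Tendsto (fun p : ℝ × ℕ × ℕ => p.1) (atTop ×ˢ atTop ×ˢ atTop) atTop := tendsto_fst
  have hmid : Tendsto (fun p : ℝ × ℕ × ℕ => p.2.1) (atTop ×ˢ atTop ×ˢ atTop) atTop :=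
    tendsto_fst.comp tendsto_snd
  have hlast : Tendsto (fun p : ℝ × ℕ × ℕ => p.2.2) (atTop ×ˢ atTop ×ˢ atTop) atTop :=
    tendsto_snd.comp tendsto_snd
  refine ⟨?_, fun n x => ?_, fun Ω _ P _ X hX hlaw hind a ha => ?_⟩
  · rw [← hinj H F₂]
    exact tendsto_nhds_zero_iff_of_tendsto_norm_sub_sq
      (tendsto_integral_mmdBNP hφ hC F₂ hfst hmid hlast (Eventually.of_forall fun _ => ‹_›)
        tendsto_const_nhds)
  · rw [← hinj H F₂]
    have hsum : Tendsto (fun a : ℝ => a + n) atTop atTop :=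
      tendsto_atTop_add_const_right _ _ tendsto_id
    have hw : Tendsto (fun a : ℝ => (n : ℝ) / (a + n)) atTop (𝓝 0) := hsum.const_div_atTop _
    have hw' : Tendsto (fun a : ℝ => a / (a + n)) atTop (𝓝 1) := by
      have : Tendsto (fun a : ℝ => 1 - (n : ℝ) / (a + n)) atTop (𝓝 1) := by
        simpa using hw.const_sub 1
      refine this.congr' ?_
      filter_upwards [hsum.eventually_gt_atTop 0] with a h
      field_simp
      ring
    have hmean : Tendsto (fun a : ℝ => ∫ y, φ y ∂(posteriorBase a H x)) atTop
        (𝓝 (∫ y, φ y ∂H)) := by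
      have := (hw'.smul_const (∫ y, φ y ∂H)).add (hw.smul_const ((n : ℝ)⁻¹ • ∑ i, φ (x i)))
      rw [one_smul, zero_smul, add_zero] at this
      refine this.congr' ?_
      filter_upwards [eventually_ge_atTop 0] with a ha
      exact (integral_posteriorBase hφ hC ha H x).symm
    refine tendsto_nhds_zero_iff_of_tendsto_norm_sub_sq
      (tendsto_integral_mmdBNP hφ hC F₂ (hsum.comp hfst) hmid hlast ?_ (hmean.comp hfst))
    filter_upwards [hfst.eventually_gt_atTop 0] with p hp
    exact isProbabilityMeasure_posteriorBase hp.le H x (by positivity)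
  -- The strong law supplies the only exceptional null set. With `a` fixed, it is the total mass `a
  -- + n → ∞` that flattens the Dirichlet weights.
  · filter_upwards [strong_law_ae_feature hφ hC hX hlaw hind] with ω hω
    rw [← hinj F₁ F₂]
    have hsum : Tendsto (fun n : ℕ => a + (n : ℝ)) atTop atTop :=
      tendsto_atTop_add_const_left _ _ tendsto_natCast_atTop_atTop
    have hw : Tendsto (fun n : ℕ => a / (a + n)) atTop (𝓝 0) := hsum.const_div_atTop _
    have hw' : Tendsto (fun n : ℕ => (n : ℝ) / (a + n)) atTop (𝓝 1) := by
      have : Tendsto (fun n : ℕ => 1 - a / (a + n)) atTop (𝓝 1) := by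
        simpa using hw.const_sub 1
      refine this.congr' ?_
      filter_upwards [hsum.eventually_gt_atTop 0] with n h
      field_simp
      ring
    have hmean : Tendsto (fun n : ℕ => ∫ y, φ y ∂(posteriorBase a H fun i : Fin n => X i ω)) atTop
        (𝓝 (∫ y, φ y ∂F₁)) := by
      have := (hw.smul_const (∫ y, φ y ∂H)).add (hw'.smul hω)
      rw [one_smul, zero_smul, zero_add] at this
      exact this.congr fun n => (integral_posteriorBase hφ hC ha H _).symm
    have hn : Tendsto (fun p : ℕ × ℕ × ℕ => p.2.1) (atTop ×ˢ atTop ×ˢ atTop) atTop :=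
      tendsto_fst.comp tendsto_snd
    refine tendsto_nhds_zero_iff_of_tendsto_norm_sub_sq
      (tendsto_integral_mmdBNP hφ hC F₂ (hsum.comp hn) tendsto_fst
        (tendsto_snd.comp tendsto_snd) ?_ (hmean.comp hn))
    -- When `a = 0`, the posterior base is a probability measure only for `n > 0`.
    filter_upwards [hn.eventually_gt_atTop 0] with p hp
    have : (0 : ℝ) < p.2.1 := Nat.cast_pos.2 hp
    exact isProbabilityMeasure_posteriorBase ha H _ (by positivity)
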